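/- **Setting.** Fix an uncountable set $V$ of names, an integer $\pi\ge 0$, and sets $\Sigma,\Delta$. A *graph* $G\in\mathcal G_{\Sigma,\Delta,\pi}$ consists of an at most countable set of vertices $V(G)\subseteq V$, a partial function $\sigma_G$ from $V(G)$ to $\Sigma$, and a partial function $\delta_G$ from $(V(G)\times\{1,\dots,\pi\})^2$ to $\Delta$ such that each port $u{:}i=(u,i)$ appears at most once in $\operatorname{dom}(\delta_G)$ (it is an end of at most one edge $(u{:}i,v{:}j)$, and of no edge is it both ends). Vertices $u,v$ are adjacent if $\delta_G(u{:}i,v{:}j)$ or $\delta_G(v{:}j,u{:}i)$ is defined for some $i,j$; the neighbours of radius $r$ of a set $A$ are the vertices of $G$ joined to an element of $A$ by a path of at most $r$ edges (possibly of length $0$). For a set $U$, with $U'=V(G)\cap U$, the *induced subgraph* $G_U$ has as vertices the neighbours of radius one of $U'$, as vertex states the restriction of $\sigma_G$ to $U'$, and as edges those of $G$ with at least one end in $U'$, with their states. The *disk* $G^r_v$ is the induced subgraph of $G$ around the set of neighbours of radius $r$ of $\{v\}$, pointed at $v$. We write $G_v$ for $G_{\{v\}}$. A bijection $R:V\to V$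 acts on graphs by renaming vertices. A *dynamics* is a function $F:\mathcal G_{\Sigma,\Delta,\pi}\to\mathcal G_{\Sigma,\Delta,\pi}$ such that (i) for every bijection $R$ of $V$ there is a bijection $R'$ of $V$ with $F(RG)=R'F(G)$ for all $G$; (ii) for every family of graphs $(G^{(i)})$, $\bigcap V(G^{(i)})=\emptyset$ implies $\bigcap V(F(G^{(i)}))=\emptyset$. For $v'\in V$ let $a(v')=\{v\in V : \forall G,\ v'\in V(F(G))\Rightarrow v\in V(G)\}$. A dynamics $F$ is *causal* if there are $r,b\in\mathbb N$ such that (i) for all $v'\in V$, $v\in a(v')$ and all graphs $G,H$, $G^r_v=H^r_v$ implies $F(G)_{v'}=F(H)_{v'}$; (ii) for all $G$ and $v\in V(G)$, $|\{v'\in V(F(G)) : v\in a(v')\}|\le b$. **Theorem (Causal, invertible, reversible).** Let $\Sigma$ and $\Delta$ be finite, and let $F$ be a causal dynamics from $\mathcal G_{\Sigma,\Delta,\pi}$ to itself. If there is a dynamics $F^\dagger$ from $\mathcal G_{\Sigma,\Delta,\pi}$ to itself with $F^\dagger\circ F=\mathrm{Id}$ and $F\circ F^\dagger=\mathrm{Id}$,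 then $F^\dagger$ is also causal. -/

import Mathlib

/-- A graph with vertex names in `V`, vertex states in `S`, edge states in `D` and ports numbered
by `Fin p`. The partial functions `σ` and `δ` are `Option`-valued and undefined (`none`) outside
the vertices of the graph. A port `u : i` of the vertex `u` is the pair `(u, i)`. -/
@[ext]
structure PortGraph (V S D : Type*) (p : ℕ) where
  /-- The set of vertices, at most countable. -/
  verts : Set V
  countable_verts : verts.Countable
  /-- The partial function giving the states of vertices. -/
  state : V → Option S
  state_eq_none : ∀ u, u ∉ verts → state u = none
  /-- The partial function giving the states of (oriented) edges. -/
  edge : V × Fin p → V × Fin p → Option D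
  edge_mem : ∀ x y, edge x y ≠ none → x.1 ∈ verts ∧ y.1 ∈ verts
  /-- Each port appears at most once in the domain of `edge`: at most once as a source, -/
  source_unique : ∀ x y z, edge x y ≠ none → edge x z ≠ none → y = z
  /-- at most once as a target, -/
  target_unique : ∀ x y z, edge y x ≠ none → edge z x ≠ none → y = z
  /-- and not both as a source and as a target. -/
  source_or_target : ∀ x y z, edge x y ≠ none → edge z x ≠ none → False

/-- A pointed graph: a graph with a set of privileged vertices. -/
@[ext]
structure PointedPortGraph (V S D : Type*) (p : ℕ) where
  graph : PortGraph V S D p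
  pointers : Set V
  pointers_subset : pointers ⊆ graph.verts

namespace PortGraph

/-- `u ⌢ v`: there is an edge between `u` and `v`, in one direction or the other. -/
def Adj {V S D : Type*} {p : ℕ} (G : PortGraph V S D p) (u v : V) : Prop :=
  ∃ i j : Fin p, G.edge (u, i) (v, j) ≠ none ∨ G.edge (v, j) (u, i) ≠ none

/-- `u ⌢ᵏ v`: there is a walk of `k` edges from `u` to `v`. -/
def AdjPow {V S D : Type*} {p : ℕ} (G : PortGraph V S D p) : ℕ → V → V → Prop
  | 0, u, v => u = v
  | k + 1, u, v => ∃ w, G.AdjPow k u w ∧ G.Adj w v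

/-- The set of neighbours of radius `r` of the set `A`. -/
def neighbours {V S D : Type*} {p : ℕ} (G : PortGraph V S D p) (r : ℕ) (A : Set V) : Set V :=
  {v | v ∈ G.verts ∧ ∃ u ∈ A, ∃ k ≤ r, G.AdjPow k u v}

theorem subset_neighbours {V S D : Type*} {p : ℕ} (G : PortGraph V S D p) (r : ℕ) (A : Set V) :
    G.verts ∩ A ⊆ G.neighbours r A :=
  fun v hv => ⟨hv.1, v, hv.2, 0, Nat.zero_le r, rfl⟩

/-- The image of a graph under the renaming of vertices by a bijection `R`. -/
def rename {V S D : Type*} {p : ℕ} (R : Equiv.Perm V) (G : PortGraph V S D p) :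
    PortGraph V S D p where
  verts := R '' G.verts
  countable_verts := G.countable_verts.image R
  state u := G.state (R.symm u)
  state_eq_none u hu := G.state_eq_none _ fun h => hu ⟨_, h, R.apply_symm_apply u⟩
  edge x y := G.edge (R.symm x.1, x.2) (R.symm y.1, y.2)
  edge_mem x y h :=
    ⟨⟨_, (G.edge_mem _ _ h).1, R.apply_symm_apply _⟩,
      ⟨_, (G.edge_mem _ _ h).2, R.apply_symm_apply _⟩⟩
  source_unique x y z h₁ h₂ := by
    have h := G.source_unique _ _ _ h₁ h₂
    simp only [Prod.mk.injEq, EmbeddingLike.apply_eq_iff_eq] at h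
    exact Prod.ext h.1 h.2
  target_unique x y z h₁ h₂ := by
    have h := G.target_unique _ _ _ h₁ h₂
    simp only [Prod.mk.injEq, EmbeddingLike.apply_eq_iff_eq] at h
    exact Prod.ext h.1 h.2
  source_or_target x y z h₁ h₂ := G.source_or_target _ _ _ h₁ h₂

open Classical in
/-- The induced subgraph `G_U`. With `U' = V(G) ∩ U`, its vertices are the neighbours of radius one
of `U'`; states are kept on `U'` only, and edges are kept if they have an end in `U'`. -/
noncomputable def induced {V S D : Type*} {p : ℕ} (G : PortGraph V S D p) (U : Set V) :
    PortGraph V S D p where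
  verts := G.neighbours 1 (G.verts ∩ U)
  countable_verts := G.countable_verts.mono fun _ h => h.1
  state u := if u ∈ G.verts ∩ U then G.state u else none
  state_eq_none u hu := if_neg fun h => hu (G.subset_neighbours 1 _ ⟨h.1, h⟩)
  edge x y :=
    if (x.1 ∈ G.neighbours 1 (G.verts ∩ U) ∧ y.1 ∈ G.verts ∩ U) ∨
        (x.1 ∈ G.verts ∩ U ∧ y.1 ∈ G.neighbours 1 (G.verts ∩ U)) then
      G.edge x y
    else none
  edge_mem x y h := by
    rcases (ite_ne_right_iff.mp h).1 with h' | h'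
    · exact ⟨h'.1, G.subset_neighbours 1 _ ⟨h'.2.1, h'.2⟩⟩
    · exact ⟨G.subset_neighbours 1 _ ⟨h'.1.1, h'.1⟩, h'.2⟩
  source_unique x y z h₁ h₂ :=
    G.source_unique x y z (ite_ne_right_iff.mp h₁).2 (ite_ne_right_iff.mp h₂).2
  target_unique x y z h₁ h₂ :=
    G.target_unique x y z (ite_ne_right_iff.mp h₁).2 (ite_ne_right_iff.mp h₂).2
  source_or_target x y z h₁ h₂ :=
    G.source_or_target x y z (ite_ne_right_iff.mp h₁).2 (ite_ne_right_iff.mp h₂).2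

/-- The envelope of radius `r` of the set `A`: the induced subgraph around the neighbours of radius
`r` of `A`, pointed at `A` (at the vertices of `G` in `A`, if `A` is not a set of vertices). -/
noncomputable def envelope {V S D : Type*} {p : ℕ} (G : PortGraph V S D p) (r : ℕ) (A : Set V) :
    PointedPortGraph V S D p where
  graph := G.induced (G.neighbours r A)
  pointers := G.verts ∩ A
  pointers_subset _ hv :=
    G.subset_neighbours 1 _ ⟨hv.1, hv.1, G.subset_neighbours r A hv⟩

/-- The disk of radius `r` around the vertex `v`. -/
noncomputable def disk {V S D : Type*} {p : ℕ} (G : PortGraph V S D p) (r : ℕ) (v : V) :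
    PointedPortGraph V S D p :=
  G.envelope r {v}

/-- A dynamics: a function from graphs to graphs satisfying conjugacy and freshness. -/
structure IsDynamics {V S D : Type*} {p : ℕ} (F : PortGraph V S D p → PortGraph V S D p) :
    Prop where
  conjugacy : ∀ R : Equiv.Perm V, ∃ R' : Equiv.Perm V, ∀ G, F (G.rename R) = (F G).rename R'
  freshness : ∀ 𝓕 : Set (PortGraph V S D p),
    (⋂ G ∈ 𝓕, G.verts) = ∅ → (⋂ G ∈ 𝓕, (F G).verts) = ∅

/-- The antecedent codynamics of `F`. -/
def antecedents {V S D : Type*} {p : ℕ} (F : PortGraph V S D p → PortGraph V S D p) (v' : V) :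
    Set V :=
  {v | ∀ G, v' ∈ (F G).verts → v ∈ G.verts}

/-- A causal dynamics. -/
structure IsCausal {V S D : Type*} {p : ℕ} (F : PortGraph V S D p → PortGraph V S D p) :
    Prop where
  isDynamics : IsDynamics F
  exists_radius_bound : ∃ r b : ℕ,
    (∀ v', ∀ v ∈ antecedents F v', ∀ G H : PortGraph V S D p,
      G.disk r v = H.disk r v → (F G).induced {v'} = (F H).induced {v'}) ∧
    (∀ G : PortGraph V S D p, ∀ v ∈ G.verts,
      {v' | v' ∈ (F G).verts ∧ v ∈ antecedents F v'}.encard ≤ b)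

/-- `F'` is a dynamics that is inverse to `F`. -/
structure IsInverseDynamics {V S D : Type*} {p : ℕ}
    (F F' : PortGraph V S D p → PortGraph V S D p) : Prop where
  isDynamics : IsDynamics F'
  comp_left : F' ∘ F = id
  comp_right : F ∘ F' = id

end PortGraph

/-! Freshness for `F` and `F'` forces the vertex sets of `G` and `F G` to correspond under one fixed
permutation `f` of names. After renaming by `f`, `F` becomes a map `K` which preserves vertices, is
local, and, by conjugacy, commutes with every renaming. It remains to see that the inverse `K'` of
such a map is local (`exists_isLocal_inverse`).

This is a compactness argument. If no radius works, there are for every `n` graphs `G n`, `H n` that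
agree on the disk of radius `n` around `v n`, while `K' (G n)` and `K' (H n)` differ at `v n`. Since
only `K` is known to be continuous, limits are taken of the preimages. After a renaming depending on
`n`, the vertices reached from `v n` by port moves in either preimage have eventually constant names
along an ultrafilter, and finiteness of `S` and `D` gives limits `P`, `Q`. By continuity, `K P` and
`K Q` agree on the whole connected component of the limit point. A local bijection respects disjoint
unions, so `K'` at a vertex depends only on its component (`agreeAt_of_agreeAt_component`). Hence
`P` and `Q` agree at the limit point, and so do the two preimages for some `n`, a contradiction. -/

namespace PortGraph

open Filter

/-! ### Local agreement of graphs, walks and disks. -/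

section Basic

variable {V S D : Type*} {p : ℕ} {G H K : PortGraph V S D p} {u v w : V} {k r : ℕ}

/-- `G` and `H` have the same state and the same incident edges at the vertex `u`. -/
structure AgreeAt (G H : PortGraph V S D p) (u : V) : Prop where
  mem_iff : u ∈ G.verts ↔ u ∈ H.verts
  state_eq : G.state u = H.state u
  edge_out : ∀ i y, G.edge (u, i) y = H.edge (u, i) y
  edge_in : ∀ i y, G.edge y (u, i) = H.edge y (u, i)

theorem AgreeAt.symm (h : AgreeAt G H u) : AgreeAt H G u :=
  ⟨h.1.symm, h.2.symm, fun i y => (h.3 i y).symm, fun i y => (h.4 i y).symm⟩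

theorem AgreeAt.trans (h : AgreeAt G H u) (h' : AgreeAt H K u) : AgreeAt G K u :=
  ⟨h.1.trans h'.1, h.2.trans h'.2, fun i y => (h.3 i y).trans (h'.3 i y),
    fun i y => (h.4 i y).trans (h'.4 i y)⟩

theorem AgreeAt.adj_iff (h : AgreeAt G H u) : G.Adj u w ↔ H.Adj u w := by
  simp only [Adj, h.edge_out, h.edge_in]

theorem edge_eq_none_left {x y : V × Fin p} (h : x.1 ∉ G.verts) : G.edge x y = none := by
  by_contra h'
  exact h (G.edge_mem _ _ h').1

theorem edge_eq_none_right {x y : V × Fin p} (h : y.1 ∉ G.verts) : G.edge x y = none := by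
  by_contra h'
  exact h (G.edge_mem _ _ h').2

theorem agreeAt_of_notMem (hG : u ∉ G.verts) (hH : u ∉ H.verts) : AgreeAt G H u :=
  ⟨by simp [hG, hH], by rw [G.state_eq_none u hG, H.state_eq_none u hH],
    fun i y => by rw [edge_eq_none_left hG, edge_eq_none_left hH],
    fun i y => by rw [edge_eq_none_right hG, edge_eq_none_right hH]⟩

theorem eq_of_agreeAt (h : ∀ u, AgreeAt G H u) : G = H := by
  ext1
  · ext u; exact (h u).mem_iff
  · ext1 u; exact (h u).state_eq
  · ext1 x; ext1 y; exact (h x.1).edge_out x.2 y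

theorem Adj.mem_left (h : G.Adj u w) : u ∈ G.verts := by
  obtain ⟨i, j, h | h⟩ := h
  · exact (G.edge_mem _ _ h).1
  · exact (G.edge_mem _ _ h).2

theorem Adj.mem_right (h : G.Adj u w) : w ∈ G.verts := by
  obtain ⟨i, j, h | h⟩ := h
  · exact (G.edge_mem _ _ h).2
  · exact (G.edge_mem _ _ h).1

theorem adj_of_edge {x y : V × Fin p} (h : G.edge x y ≠ none) : G.Adj x.1 y.1 :=
  ⟨x.2, y.2, Or.inl h⟩

theorem Adj.symm (h : G.Adj u w) : G.Adj w u := by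
  obtain ⟨i, j, h | h⟩ := h
  exacts [⟨j, i, Or.inr h⟩, ⟨j, i, Or.inl h⟩]

theorem AdjPow.mem_of_verts_subset {X : Set V} (hX : G.verts ⊆ X) (hv : v ∈ X)
    (h : G.AdjPow k v u) : u ∈ X := by
  cases k with
  | zero => exact (show v = u from h) ▸ hv
  | succ k => obtain ⟨w, -, h⟩ := h; exact hX h.mem_right

theorem AdjPow.mem (hv : v ∈ G.verts) (h : G.AdjPow k v u) : u ∈ G.verts :=
  h.mem_of_verts_subset subset_rfl hv

/-- Agreement at distance `< k` suffices: the last edge of a walk is seen from its penultimate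
vertex. -/
theorem adjPow_iff_of_agreeAt
    (h : ∀ j < k, ∀ u, G.AdjPow j v u → AgreeAt G H u) : G.AdjPow k v u ↔ H.AdjPow k v u := by
  induction k generalizing u with
  | zero => exact Iff.rfl
  | succ k ih =>
    have ih' := fun w => ih (u := w) fun j hj => h j (by omega)
    constructor
    · rintro ⟨w, h1, h2⟩
      exact ⟨w, (ih' w).1 h1, (h k (by omega) w h1).adj_iff.1 h2⟩
    · rintro ⟨w, h1, h2⟩
      exact ⟨w, (ih' w).2 h1, (h k (by omega) w ((ih' w).2 h1)).adj_iff.2 h2⟩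

theorem mem_neighbours_one {A : Set V} (hA : A ⊆ G.verts) :
    w ∈ G.neighbours 1 A ↔ w ∈ A ∨ ∃ u ∈ A, G.Adj u w := by
  constructor
  · rintro ⟨hw, u, hu, k, hk, h⟩
    interval_cases k
    · exact Or.inl ((show u = w from h) ▸ hu)
    · obtain ⟨w', h1, h2⟩ := h
      exact Or.inr ⟨u, hu, (show u = w' from h1) ▸ h2⟩
  · rintro (h | ⟨u, hu, h⟩)
    · exact ⟨hA h, w, h, 0, by omega, rfl⟩
    · exact ⟨h.mem_right, u, hu, 1, le_rfl, u, rfl, h⟩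

theorem agreeAt_induced {U : Set V} (hu : u ∈ U) : AgreeAt G (G.induced U) u := by
  by_cases hv : u ∈ G.verts
  swap
  · exact agreeAt_of_notMem hv fun h => hv h.1
  have hn := G.subset_neighbours 1 (G.verts ∩ U) ⟨hv, hv, hu⟩
  refine ⟨iff_of_true hv hn, by simp [induced, hv, hu], fun i y => ?_, fun i y => ?_⟩
  · by_cases h : G.edge (u, i) y = none
    · simp [induced, h]
    · refine (if_pos (Or.inr ⟨⟨hv, hu⟩, ?_⟩)).symm
      exact (mem_neighbours_one Set.inter_subset_left).2 (Or.inr ⟨u, ⟨hv, hu⟩, adj_of_edge h⟩)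
  · by_cases h : G.edge y (u, i) = none
    · simp [induced, h]
    · refine (if_pos (Or.inl ⟨?_, ⟨hv, hu⟩⟩)).symm
      exact (mem_neighbours_one Set.inter_subset_left).2
        (Or.inr ⟨u, ⟨hv, hu⟩, (adj_of_edge h).symm⟩)

open Classical in
theorem induced_congr {U : Set V} (h : ∀ u ∈ U, AgreeAt G H u) : G.induced U = H.induced U := by
  have h1 : G.verts ∩ U = H.verts ∩ U := by
    ext u
    simp only [Set.mem_inter_iff, and_congr_left_iff]
    exact fun hu => (h u hu).mem_iff
  have h2 : G.neighbours 1 (G.verts ∩ U) = H.neighbours 1 (H.verts ∩ U) := by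
    ext w
    rw [mem_neighbours_one Set.inter_subset_left, mem_neighbours_one Set.inter_subset_left, h1]
    refine or_congr_right (exists_congr fun u => and_congr_right fun hu => ?_)
    exact (h u hu.2).adj_iff
  ext1
  · exact h2
  · ext1 u
    by_cases hu : u ∈ U
    · show ite _ _ _ = ite _ _ _
      exact if_congr (by rw [h1]) (h u hu).state_eq rfl
    · simp [induced, hu]
  · ext1 x; ext1 y
    by_cases hx : x.1 ∈ U
    · show ite _ _ _ = ite _ _ _
      exact if_congr (by rw [h2, h1]) ((h x.1 hx).edge_out x.2 y) rfl
    by_cases hy : y.1 ∈ U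
    · show ite _ _ _ = ite _ _ _
      exact if_congr (by rw [h2, h1]) ((h y.1 hy).edge_in y.2 x) rfl
    · simp [induced, hx, hy]

theorem induced_singleton_eq_iff : G.induced {u} = H.induced {u} ↔ AgreeAt G H u := by
  constructor
  · intro h
    have h1 : AgreeAt G (G.induced {u}) u := agreeAt_induced rfl
    rw [h] at h1
    exact h1.trans (agreeAt_induced (G := H) (U := {u}) rfl).symm
  · intro h
    exact induced_congr fun w hw => (show w = u from hw) ▸ h

theorem disk_eq_of_agreeAt (h : ∀ k ≤ r, ∀ u, G.AdjPow k v u → AgreeAt G H u) :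
    G.disk r v = H.disk r v := by
  have hv : AgreeAt G H v := h 0 (by omega) v rfl
  have hn : G.neighbours r {v} = H.neighbours r {v} := by
    ext u
    simp only [neighbours, Set.mem_ofPred_eq, Set.mem_singleton_iff, exists_eq_left]
    constructor
    · rintro ⟨h1, k, hk, h2⟩
      exact ⟨(h k hk u h2).mem_iff.1 h1, k, hk,
        (adjPow_iff_of_agreeAt fun j hj => h j (by omega)).1 h2⟩
    · rintro ⟨h1, k, hk, h2⟩
      have h2 := (adjPow_iff_of_agreeAt fun j hj => h j (by omega)).2 h2
      exact ⟨(h k hk u h2).mem_iff.2 h1, k, hk, h2⟩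
  ext1
  · simp only [disk, envelope, ← hn]
    refine induced_congr ?_
    rintro u ⟨-, v', hv', k, hk, hu⟩
    rw [Set.mem_singleton_iff.1 hv'] at hu
    exact h k hk u hu
  · ext u
    simp only [disk, envelope, Set.mem_inter_iff, Set.mem_singleton_iff, and_congr_left_iff]
    rintro rfl
    exact hv.mem_iff

/-- Equal disks have equal underlying graphs, but agreement at `u` also needs `u` to be reached in
`H`. The two facts are therefore proved together, by induction along the walk. -/
theorem agreeAt_of_disk_eq (h : G.disk r v = H.disk r v) (hk : k ≤ r) (hu : G.AdjPow k v u) :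
    AgreeAt G H u := by
  have hv : v ∈ G.verts ↔ v ∈ H.verts := by
    have := Set.ext_iff.1 (congrArg PointedPortGraph.pointers h) v
    simpa [disk, envelope] using this
  have hg : G.induced (G.neighbours r {v}) = H.induced (H.neighbours r {v}) :=
    congrArg PointedPortGraph.graph h
  by_cases hvG : v ∈ G.verts
  · have hvH := hv.1 hvG
    suffices AgreeAt G H u ∧ H.AdjPow k v u from this.1
    have key : ∀ k ≤ r, ∀ u, G.AdjPow k v u → H.AdjPow k v u → AgreeAt G H u := by
      intro k hk u h1 h2
      have a1 : AgreeAt G (G.induced (G.neighbours r {v})) u :=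
        agreeAt_induced ⟨h1.mem hvG, v, rfl, k, hk, h1⟩
      have a2 : AgreeAt H (H.induced (H.neighbours r {v})) u :=
        agreeAt_induced ⟨h2.mem hvH, v, rfl, k, hk, h2⟩
      rw [hg] at a1
      exact a1.trans a2.symm
    induction k generalizing u with
    | zero => exact ⟨key 0 hk u hu hu, hu⟩
    | succ k ih =>
      obtain ⟨w, h1, h2⟩ := hu
      obtain ⟨i1, i2⟩ := ih (by omega) h1
      have h3 : H.AdjPow (k + 1) v u := ⟨w, i2, i1.adj_iff.1 h2⟩
      exact ⟨key (k + 1) hk u ⟨w, h1, h2⟩ h3, h3⟩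
  -- No edge leaves a non-vertex, so only the trivial walk starts at `v`.
  · have : u = v := by
      induction k generalizing u with
      | zero => exact (show v = u from hu).symm
      | succ k ih =>
        obtain ⟨w, h1, h2⟩ := hu
        rw [ih (by omega) h1] at h2
        exact absurd h2.mem_left hvG
    subst this
    exact agreeAt_of_notMem hvG fun h => hvG (hv.2 h)

/-- There are finitely many ports, and each has at most one partner as a source and one as a target.
-/
theorem finite_setOf_adj (G : PortGraph V S D p) (u : V) : {w | G.Adj u w}.Finite := by
  have : {w | G.Adj u w} ⊆ ⋃ i : Fin p,
      Prod.fst '' {y | G.edge (u, i) y ≠ none} ∪ Prod.fst '' {y | G.edge y (u, i) ≠ none} := by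
    rintro w ⟨i, j, h | h⟩
    · exact Set.mem_iUnion.2 ⟨i, Or.inl ⟨(w, j), h, rfl⟩⟩
    · exact Set.mem_iUnion.2 ⟨i, Or.inr ⟨(w, j), h, rfl⟩⟩
  refine (Set.finite_iUnion fun i => ?_).subset this
  refine Set.Finite.union (Set.Finite.image _ ?_) (Set.Finite.image _ ?_)
  · exact Set.Subsingleton.finite fun y hy z hz => G.source_unique _ _ _ hy hz
  · exact Set.Subsingleton.finite fun y hy z hz => G.target_unique _ _ _ hy hz

theorem finite_setOf_adjPow (G : PortGraph V S D p) (k : ℕ) (u : V) :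
    {w | G.AdjPow k u w}.Finite := by
  induction k with
  | zero => exact Set.Subsingleton.finite fun y hy z hz => Eq.trans (Eq.symm hy) hz
  | succ k ih =>
    refine (ih.biUnion fun w _ => G.finite_setOf_adj w).subset ?_
    rintro w ⟨w', h1, h2⟩
    exact Set.mem_biUnion h1 h2

/-- A map on graphs is local with radius `r` if the image at `v` depends only on the disk of
radius `r` around `v`. -/
def IsLocal (F : PortGraph V S D p → PortGraph V S D p) (r : ℕ) : Prop :=
  ∀ G H v, (∀ k ≤ r, ∀ u, G.AdjPow k v u → AgreeAt G H u) → AgreeAt (F G) (F H) v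

end Basic

/-! ### Renaming. -/

section Rename

variable {V S D : Type*} {p : ℕ} {G H : PortGraph V S D p} {u v : V} {k : ℕ} {R : Equiv.Perm V}

theorem mem_rename_verts : u ∈ (G.rename R).verts ↔ R.symm u ∈ G.verts :=
  Set.mem_image_equiv

theorem agreeAt_rename : AgreeAt (G.rename R) (H.rename R) u ↔ AgreeAt G H (R.symm u) := by
  constructor
  · intro h
    refine ⟨by simpa [mem_rename_verts] using h.1, h.2, fun i y => ?_, fun i y => ?_⟩
    · simpa [rename] using h.3 i (R y.1, y.2)
    · simpa [rename] using h.4 i (R y.1, y.2)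
  · intro h
    exact ⟨by simpa [mem_rename_verts] using h.1, h.2,
      fun i y => h.3 i _, fun i y => h.4 i _⟩

theorem adj_rename : (G.rename R).Adj u v ↔ G.Adj (R.symm u) (R.symm v) := Iff.rfl

theorem adjPow_rename :
    (G.rename R).AdjPow k u v ↔ G.AdjPow k (R.symm u) (R.symm v) := by
  induction k generalizing v with
  | zero => exact R.symm.apply_eq_iff_eq.symm
  | succ k ih =>
    constructor
    · rintro ⟨w, h1, h2⟩
      exact ⟨R.symm w, ih.1 h1, h2⟩
    · rintro ⟨w, h1, h2⟩
      exact ⟨R w, ih.2 (by simpa using h1), by simpa [adj_rename] using h2⟩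

theorem rename_rename (R' : Equiv.Perm V) : (G.rename R).rename R' = G.rename (R' * R) := by
  ext1
  · simp [rename, Set.image_image]
  · rfl
  · rfl

theorem rename_one : G.rename 1 = G := by
  ext1
  · simp [rename]
  · rfl
  · rfl

end Rename

/-! ### Disjoint unions and connected components. -/

section Union

variable {V S D : Type*} {p : ℕ}

open Classical in
/-- The restriction of a graph to a set of vertices. -/
noncomputable def restrict (G : PortGraph V S D p) (C : Set V) : PortGraph V S D p where
  verts := G.verts ∩ C
  countable_verts := G.countable_verts.mono Set.inter_subset_left
  state u := if u ∈ C then G.state u else none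
  state_eq_none u hu := by
    by_cases h : u ∈ C
    · rw [if_pos h]; exact G.state_eq_none u fun h' => hu ⟨h', h⟩
    · rw [if_neg h]
  edge x y := if x.1 ∈ C ∧ y.1 ∈ C then G.edge x y else none
  edge_mem x y h := by
    obtain ⟨h1, h2⟩ := ite_ne_right_iff.mp h
    exact ⟨⟨(G.edge_mem _ _ h2).1, h1.1⟩, (G.edge_mem _ _ h2).2, h1.2⟩
  source_unique x y z h₁ h₂ :=
    G.source_unique x y z (ite_ne_right_iff.mp h₁).2 (ite_ne_right_iff.mp h₂).2
  target_unique x y z h₁ h₂ :=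
    G.target_unique x y z (ite_ne_right_iff.mp h₁).2 (ite_ne_right_iff.mp h₂).2
  source_or_target x y z h₁ h₂ :=
    G.source_or_target x y z (ite_ne_right_iff.mp h₁).2 (ite_ne_right_iff.mp h₂).2

theorem restrict_agreeAt {G : PortGraph V S D p} {C : Set V}
    (hC : ∀ u ∈ C, ∀ w, G.Adj u w → w ∈ C) {u : V} (hu : u ∈ C) :
    AgreeAt (G.restrict C) G u := by
  refine ⟨by simp [restrict, hu], by simp [restrict, hu], fun i y => ?_, fun i y => ?_⟩
  · by_cases h : G.edge (u, i) y = none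
    · simp [restrict, h]
    · exact if_pos ⟨hu, hC u hu _ (adj_of_edge h)⟩
  · by_cases h : G.edge y (u, i) = none
    · simp [restrict, h]
    · exact if_pos ⟨hC u hu _ (adj_of_edge h).symm, hu⟩

open Classical in
/-- The union of two graphs with disjoint sets of vertices. -/
noncomputable def disjUnion (A B : PortGraph V S D p) (h : Disjoint A.verts B.verts) :
    PortGraph V S D p where
  verts := A.verts ∪ B.verts
  countable_verts := A.countable_verts.union B.countable_verts
  state u := if u ∈ A.verts then A.state u else B.state u
  state_eq_none u hu := by
    rw [Set.mem_union, not_or] at hu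
    rw [if_neg hu.1, B.state_eq_none u hu.2]
  edge x y := if x.1 ∈ A.verts then A.edge x y else B.edge x y
  edge_mem x y h := by
    split_ifs at h with h'
    · exact ⟨Or.inl (A.edge_mem _ _ h).1, Or.inl (A.edge_mem _ _ h).2⟩
    · exact ⟨Or.inr (B.edge_mem _ _ h).1, Or.inr (B.edge_mem _ _ h).2⟩
  source_unique x y z h₁ h₂ := by
    split_ifs at h₁ h₂
    · exact A.source_unique _ _ _ h₁ h₂
    · exact B.source_unique _ _ _ h₁ h₂
  target_unique x y z h₁ h₂ := by
    split_ifs at h₁ h₂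
    · exact A.target_unique _ _ _ h₁ h₂
    · exact (Set.disjoint_left.1 h (A.edge_mem _ _ h₁).2 (B.edge_mem _ _ h₂).2).elim
    · exact (Set.disjoint_left.1 h (A.edge_mem _ _ h₂).2 (B.edge_mem _ _ h₁).2).elim
    · exact B.target_unique _ _ _ h₁ h₂
  source_or_target x y z h₁ h₂ := by
    split_ifs at h₁ h₂ with h3 h4
    · exact A.source_or_target _ _ _ h₁ h₂
    · exact (Set.disjoint_left.1 h h3 (B.edge_mem _ _ h₂).2).elim
    · exact h3 (A.edge_mem _ _ h₂).2
    · exact B.source_or_target _ _ _ h₁ h₂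

variable {A B : PortGraph V S D p} {h : Disjoint A.verts B.verts} {u : V}

theorem disjUnion_agreeAt_left (hu : u ∈ A.verts) : AgreeAt (disjUnion A B h) A u := by
  refine ⟨by simp [disjUnion, hu], if_pos hu, fun i y => if_pos hu, fun i y => ?_⟩
  by_cases hy : y.1 ∈ A.verts
  · exact if_pos hy
  · rw [edge_eq_none_left hy]
    refine (if_neg hy).trans (edge_eq_none_right (Set.disjoint_left.1 h hu))

theorem disjUnion_agreeAt_right (hu : u ∈ B.verts) : AgreeAt (disjUnion A B h) B u := by
  have hA := Set.disjoint_right.1 h hu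
  refine ⟨by simp [disjUnion, hu], if_neg hA, fun i y => if_neg hA, fun i y => ?_⟩
  by_cases hy : y.1 ∈ A.verts
  · rw [edge_eq_none_left (Set.disjoint_left.1 h hy)]
    exact (if_pos hy).trans (edge_eq_none_right hA)
  · exact if_neg hy

variable {K K' : PortGraph V S D p → PortGraph V S D p} {r : ℕ}

/-- The inverse of a local vertex-preserving map commutes with disjoint unions. -/
theorem map_disjUnion_of_isLocal (hloc : IsLocal K r) (hverts : ∀ G, (K G).verts = G.verts)
    (hverts' : ∀ G, (K' G).verts = G.verts)
    (hl : ∀ G, K' (K G) = G) (hr : ∀ G, K (K' G) = G) :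
    K' (disjUnion A B h) = disjUnion (K' A) (K' B) (by rwa [hverts', hverts']) := by
  have h' : Disjoint (K' A).verts (K' B).verts := by rwa [hverts', hverts']
  -- The identity is checked after applying `K`, whose locality is known: walks from a vertex of one
  -- summand never leave it.
  suffices disjUnion A B h = K (disjUnion (K' A) (K' B) h') by rw [this, hl]
  refine eq_of_agreeAt fun u => ?_
  by_cases hA : u ∈ A.verts
  · refine (disjUnion_agreeAt_left hA).trans ?_
    rw [← hverts' A] at hA
    have := hloc (K' A) (disjUnion (K' A) (K' B) h') u fun k _ w hw =>
      (disjUnion_agreeAt_left (hw.mem hA)).symm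
    rwa [hr] at this
  by_cases hB : u ∈ B.verts
  · refine (disjUnion_agreeAt_right hB).trans ?_
    rw [← hverts' B] at hB
    have := hloc (K' B) (disjUnion (K' A) (K' B) h') u fun k _ w hw =>
      (disjUnion_agreeAt_right (hw.mem hB)).symm
    rwa [hr] at this
  · refine agreeAt_of_notMem (by simp [disjUnion, hA, hB]) ?_
    rw [hverts]
    simp [disjUnion, hverts', hA, hB]

/-- The inverse of a local vertex-preserving map can be computed on unions of components. -/
theorem agreeAt_map_restrict_of_isLocal (hloc : IsLocal K r)
    (hverts : ∀ G, (K G).verts = G.verts) (hverts' : ∀ G, (K' G).verts = G.verts)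
    (hl : ∀ G, K' (K G) = G) (hr : ∀ G, K (K' G) = G)
    {G : PortGraph V S D p} {C : Set V} (hC : ∀ u ∈ C, ∀ w, G.Adj u w → w ∈ C) (hu : u ∈ C) :
    AgreeAt (K' (G.restrict C)) (K' G) u := by
  have hd : Disjoint (G.restrict C).verts (G.restrict Cᶜ).verts :=
    Set.disjoint_left.2 fun x h1 h2 => h2.2 h1.2
  have hC' : ∀ u ∈ Cᶜ, ∀ w, G.Adj u w → w ∈ Cᶜ := fun u hu w h hw => hu (hC w hw u h.symm)
  have hG : disjUnion _ _ hd = G := by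
    refine eq_of_agreeAt fun u => ?_
    by_cases hm : u ∈ G.verts
    · by_cases huC : u ∈ C
      · exact (disjUnion_agreeAt_left (A := G.restrict C) ⟨hm, huC⟩).trans (restrict_agreeAt hC huC)
      · exact (disjUnion_agreeAt_right (B := G.restrict Cᶜ) ⟨hm, huC⟩).trans (restrict_agreeAt hC' huC)
    · exact agreeAt_of_notMem (by simp [disjUnion, restrict, hm]) hm
  by_cases hm : u ∈ G.verts
  · have e := map_disjUnion_of_isLocal (h := hd) hloc hverts hverts' hl hr
    rw [hG] at e
    rw [e]
    refine (disjUnion_agreeAt_left ?_).symm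
    rw [hverts']
    exact ⟨hm, hu⟩
  · refine agreeAt_of_notMem ?_ (by rwa [hverts'])
    rw [hverts']
    exact fun h => hm h.1

/-- The set reached from `v` is closed under adjacency in both graphs and they have the same
restriction to it. This is locality of `K'` with infinite radius. -/
theorem agreeAt_of_agreeAt_component (hloc : IsLocal K r)
    (hverts : ∀ G, (K G).verts = G.verts) (hverts' : ∀ G, (K' G).verts = G.verts)
    (hl : ∀ G, K' (K G) = G) (hr : ∀ G, K (K' G) = G)
    {G H : PortGraph V S D p} {v : V} (hagree : ∀ k u, G.AdjPow k v u → AgreeAt G H u) :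
    AgreeAt (K' G) (K' H) v := by
  set C : Set V := {u | ∃ k, G.AdjPow k v u} with hCdef
  have hv : v ∈ C := ⟨0, rfl⟩
  have hag : ∀ u ∈ C, AgreeAt G H u := by
    rintro u ⟨k, hk⟩
    exact hagree k u hk
  have hC : ∀ u ∈ C, ∀ w, G.Adj u w → w ∈ C := by
    rintro u ⟨k, hk⟩ w h
    exact ⟨k + 1, u, hk, h⟩
  have hC' : ∀ u ∈ C, ∀ w, H.Adj u w → w ∈ C := fun u hu w h =>
    hC u hu w ((hag u hu).adj_iff.2 h)
  have e : G.restrict C = H.restrict C := by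
    refine eq_of_agreeAt fun u => ?_
    by_cases hu : u ∈ C
    · exact (restrict_agreeAt hC hu).trans ((hag u hu).trans (restrict_agreeAt hC' hu).symm)
    · exact agreeAt_of_notMem (fun h => hu h.2) fun h => hu h.2
  have h1 := agreeAt_map_restrict_of_isLocal hloc hverts hverts' hl hr hC hv
  have h2 := agreeAt_map_restrict_of_isLocal hloc hverts hverts' hl hr hC' hv
  rw [e] at h1
  exact h1.symm.trans h2

end Union

/-! ### Limits of graphs along an ultrafilter. -/

section Limit

variable {V S D : Type*} {p : ℕ} {ι : Type*}

theorem exists_eventually_eq {T : Type*} [Finite T] (U : Ultrafilter ι) (f : ι → T) :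
    ∃ t, ∀ᶠ n in U, f n = t := by
  obtain ⟨t, ht⟩ := Ultrafilter.eq_pure_of_finite (U.map f)
  refine ⟨t, ?_⟩
  have : {t} ∈ U.map f := by rw [ht]; exact Set.mem_singleton t
  exact this

/-- The limit of a function with values in a finite type along an ultrafilter. -/
noncomputable def finLim {T : Type*} [Finite T] (U : Ultrafilter ι) (f : ι → T) : T :=
  (exists_eventually_eq U f).choose

theorem eventually_eq_finLim {T : Type*} [Finite T] (U : Ultrafilter ι) (f : ι → T) :
    ∀ᶠ n in U, f n = finLim U f :=
  (exists_eventually_eq U f).choose_spec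

variable [Finite S] [Finite D]

open Classical in
/-- The pointwise limit of graphs along an ultrafilter, on a countable set of vertices. -/
noncomputable def limit (U : Ultrafilter ι) (X : Set V) (hX : X.Countable)
    (G : ι → PortGraph V S D p) : PortGraph V S D p where
  verts := {x | x ∈ X ∧ ∀ᶠ n in U, x ∈ (G n).verts}
  countable_verts := hX.mono fun _ h => h.1
  state u := if u ∈ X then finLim U fun n => (G n).state u else none
  state_eq_none u hu := by
    split_ifs with h
    · have h' : ∀ᶠ n in U, u ∉ (G n).verts :=
        Ultrafilter.eventually_not.2 fun h' => hu ⟨h, h'⟩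
      obtain ⟨n, h1, h2⟩ := (h'.and (eventually_eq_finLim U fun n => (G n).state u)).exists
      exact h2.symm.trans ((G n).state_eq_none u h1)
    · rfl
  edge x y := if x.1 ∈ X ∧ y.1 ∈ X then finLim U fun n => (G n).edge x y else none
  edge_mem x y h := by
    obtain ⟨hX, hne⟩ := ite_ne_right_iff.mp h
    have hmem : ∀ᶠ n in U, x.1 ∈ (G n).verts ∧ y.1 ∈ (G n).verts := by
      filter_upwards [eventually_eq_finLim U fun n => (G n).edge x y] with n hn
      exact (G n).edge_mem x y (hn ▸ hne)
    exact ⟨⟨hX.1, hmem.mono fun _ h => h.1⟩, hX.2, hmem.mono fun _ h => h.2⟩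
  source_unique x y z h₁ h₂ := by
    have e1 := eventually_eq_finLim U fun n => (G n).edge x y
    have e2 := eventually_eq_finLim U fun n => (G n).edge x z
    obtain ⟨n, h3, h4⟩ := (e1.and e2).exists
    exact (G n).source_unique x y z (h3 ▸ (ite_ne_right_iff.mp h₁).2)
      (h4 ▸ (ite_ne_right_iff.mp h₂).2)
  target_unique x y z h₁ h₂ := by
    have e1 := eventually_eq_finLim U fun n => (G n).edge y x
    have e2 := eventually_eq_finLim U fun n => (G n).edge z x
    obtain ⟨n, h3, h4⟩ := (e1.and e2).exists
    exact (G n).target_unique x y z (h3 ▸ (ite_ne_right_iff.mp h₁).2)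
      (h4 ▸ (ite_ne_right_iff.mp h₂).2)
  source_or_target x y z h₁ h₂ := by
    have e1 := eventually_eq_finLim U fun n => (G n).edge x y
    have e2 := eventually_eq_finLim U fun n => (G n).edge z x
    obtain ⟨n, h3, h4⟩ := (e1.and e2).exists
    exact (G n).source_or_target x y z (h3 ▸ (ite_ne_right_iff.mp h₁).2)
      (h4 ▸ (ite_ne_right_iff.mp h₂).2)

/-- Each port of each vertex in `X` is eventually linked to no other vertex than some fixed
element of `X`. -/
def Stabilizes (U : Ultrafilter ι) (X : Set V) (G : ι → PortGraph V S D p) : Prop :=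
  ∀ x ∈ X, ∀ i, ∃ y ∈ X, ∀ᶠ n in U, ∀ z,
    (G n).edge (x, i) z ≠ none ∨ (G n).edge z (x, i) ≠ none → z.1 = y

variable {U : Ultrafilter ι} {X : Set V} {hX : X.Countable} {G : ι → PortGraph V S D p}

theorem eventually_edge_eq_limit {x y : V × Fin p} (hx : x.1 ∈ X) (hy : y.1 ∈ X) :
    ∀ᶠ n in U, (limit U X hX G).edge x y = (G n).edge x y := by
  filter_upwards [eventually_eq_finLim U fun n => (G n).edge x y] with n hn
  rw [hn]
  exact if_pos ⟨hx, hy⟩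

/-- Convergence of each edge value separately is not enough, as infinitely many pairs of ports
involve `x`. Stabilization leaves only finitely many relevant pairs, those with the fixed partner
`y`. -/
theorem Stabilizes.eventually_agreeAt_limit (hG : Stabilizes U X G) {x : V} (hx : x ∈ X) :
    ∀ᶠ n in U, AgreeAt (limit U X hX G) (G n) x := by
  have hst : ∀ᶠ n in U, (limit U X hX G).state x = (G n).state x := by
    filter_upwards [eventually_eq_finLim U fun n => (G n).state x] with n hn
    rw [hn]
    exact if_pos hx
  have hed : ∀ᶠ n in U, ∀ i, ∀ z, (limit U X hX G).edge (x, i) z = (G n).edge (x, i) z ∧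
      (limit U X hX G).edge z (x, i) = (G n).edge z (x, i) := by
    rw [eventually_all]
    intro i
    obtain ⟨y, hy, hlink⟩ := hG x hx i
    have h1 : ∀ᶠ n in U, ∀ j : Fin p,
        (limit U X hX G).edge (x, i) (y, j) = (G n).edge (x, i) (y, j) := by
      rw [eventually_all]
      exact fun j => eventually_edge_eq_limit hx hy
    have h2 : ∀ᶠ n in U, ∀ j : Fin p,
        (limit U X hX G).edge (y, j) (x, i) = (G n).edge (y, j) (x, i) := by
      rw [eventually_all]
      exact fun j => eventually_edge_eq_limit hy hx
    filter_upwards [h1, h2, hlink] with n h1 h2 h3 z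
    by_cases hz : z.1 = y
    · obtain ⟨z, j⟩ := z
      subst hz
      exact ⟨h1 j, h2 j⟩
    · have h4 := fun h => hz (h3 z h)
      have h4 : (G n).edge (x, i) z = none ∧ (G n).edge z (x, i) = none := by
        rwa [imp_false, not_or, not_not, not_not] at h4
      rw [h4.1, h4.2]
      constructor
      -- An edge of the limit is an edge of some `G m` for which the partner is already `y`.
      · by_contra hne
        have hzX := ((limit U X hX G).edge_mem _ _ hne).2.1
        obtain ⟨m, e1, e2⟩ := ((eventually_edge_eq_limit (hX := hX) (G := G) (U := U)
          (x := (x, i)) (y := z) hx hzX).and hlink).exists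
        exact hz (e2 z (Or.inl (e1 ▸ hne)))
      · by_contra hne
        have hzX := ((limit U X hX G).edge_mem _ _ hne).1.1
        obtain ⟨m, e1, e2⟩ := ((eventually_edge_eq_limit (hX := hX) (G := G) (U := U)
          (x := z) (y := (x, i)) hzX hx).and hlink).exists
        exact hz (e2 z (Or.inr (e1 ▸ hne)))
  have hmem : ∀ᶠ n in U, x ∈ (limit U X hX G).verts ↔ x ∈ (G n).verts := by
    by_cases h : ∀ᶠ n in U, x ∈ (G n).verts
    · filter_upwards [h] with n hn
      exact iff_of_true ⟨hx, h⟩ hn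
    · filter_upwards [Ultrafilter.eventually_not.2 h] with n hn
      exact iff_of_false (fun h' => h h'.2) hn
  filter_upwards [hmem, hst, hed] with n h1 h2 h3
  exact ⟨h1, h2, fun i y => (h3 i y).1, fun i y => (h3 i y).2⟩

/-- A local map commutes with limits. -/
theorem Stabilizes.eventually_agreeAt_map_limit (hG : Stabilizes U X G)
    {K : PortGraph V S D p → PortGraph V S D p} {r : ℕ} (hloc : IsLocal K r)
    {x : V} (hx : x ∈ X) :
    ∀ᶠ n in U, AgreeAt (K (limit U X hX G)) (K (G n)) x := by
  -- The ball of radius `r` in the limit graph is finite and lies in `X`, so agreement holds on all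
  -- of it at once.
  have : ∀ᶠ n in U, ∀ k ∈ Set.Iic r, ∀ u ∈ {u | (limit U X hX G).AdjPow k x u},
      AgreeAt (limit U X hX G) (G n) u := by
    rw [eventually_all_finite (Set.finite_Iic r)]
    intro k _
    rw [eventually_all_finite (finite_setOf_adjPow _ _ _)]
    intro u hu
    exact hG.eventually_agreeAt_limit 
        (AdjPow.mem_of_verts_subset (G := limit U X hX G) (fun _ h => h.1) hx hu)
  filter_upwards [this] with n hn
  exact hloc _ _ _ hn

end Limit

/-! ### Choosing names that converge. -/

section Names

variable {V S D : Type*} {p : ℕ}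

theorem exists_perm_apply_eq {α : Type*} (T : Finset α) (a b : α → V)
    (h : ∀ x ∈ T, ∀ y ∈ T, a x = a y ↔ b x = b y) :
    ∃ R : Equiv.Perm V, ∀ x ∈ T, R (a x) = b x := by
  classical
  induction T using Finset.induction_on with
  | empty => exact ⟨1, by simp⟩
  | insert w T _ ih =>
    obtain ⟨R, hR⟩ := ih fun x hx y hy => h x (by simp [hx]) y (by simp [hy])
    by_cases hw : ∃ x ∈ T, a x = a w
    · obtain ⟨x, hx, e⟩ := hw
      refine ⟨R, fun y hy => ?_⟩
      rcases Finset.mem_insert.1 hy with rfl | hy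
      · rw [← e, hR x hx, ← h x (by simp [hx]) y (by simp), e]
      · exact hR y hy
    · push Not at hw
      -- The transposition corrects the value at `a w`; it moves no earlier `b y`, because `a w` and
      -- `b w` are both new.
      refine ⟨Equiv.swap (R (a w)) (b w) * R, fun y hy => ?_⟩
      rcases Finset.mem_insert.1 hy with rfl | hy
      · simp
      · rw [Equiv.Perm.mul_apply, Equiv.swap_apply_of_ne_of_ne, hR y hy]
        · exact fun e => hw y hy (R.injective e)
        · rw [hR y hy]
          exact fun e => hw y hy ((h y (by simp [hy]) w (by simp)).2 e)

/-- Countably many sequences of names can be made eventually constant, along an ultrafilter, by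
renaming. -/
theorem exists_perm_eventually_eq [Infinite V] {α : Type*} [Countable α] (U : Ultrafilter ℕ)
    (hU : (U : Filter ℕ) ≤ atTop) (s : α → ℕ → V) :
    ∃ (R : ℕ → Equiv.Perm V) (name : α → V), ∀ w, ∀ᶠ n in U, R n (s w n) = name w := by
  classical
  have := Encodable.ofCountable α
  let germ : α → Germ (U : Filter ℕ) V := fun w => (s w : Germ (U : Filter ℕ) V)
  have hcount : Countable (Set.range germ) := (Set.countable_range germ).to_subtype
  obtain ⟨c, hc⟩ := exists_injective_nat (Set.range germ)
  -- One name for each germ: there are countably many germs, so they embed in the infinite set `V`,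
  -- and sequences share a name exactly when they are eventually equal.
  let name : α → V := fun w => Infinite.natEmbedding V (c ⟨germ w, w, rfl⟩)
  have hname : ∀ w w', ∀ᶠ n in U, s w n = s w' n ↔ name w = name w' := by
    intro w w'
    have e : name w = name w' ↔ ∀ᶠ n in U, s w n = s w' n := by
      refine (Infinite.natEmbedding V).injective.eq_iff.trans (hc.eq_iff.trans ?_)
      exact Subtype.mk_eq_mk.trans Germ.coe_eq
    by_cases h : name w = name w'
    · filter_upwards [e.1 h] with n hn
      simp [h, hn]
    · have h' := h
      rw [e, Ultrafilter.eventually_not.symm] at h'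
      filter_upwards [h'] with n hn
      simp [h, hn]
  let Q : ℕ → ℕ → Prop := fun n m =>
    ∃ R : Equiv.Perm V, ∀ w, Encodable.encode w < m → R (s w n) = name w
  have hQ : ∀ m, ∀ᶠ n in U, Q n m := by
    intro m
    have hfin : {w : α | Encodable.encode w < m}.Finite :=
      (Set.finite_Iio m).preimage Encodable.encode_injective.injOn
    have : ∀ᶠ n in U, ∀ w ∈ {w : α | Encodable.encode w < m},
        ∀ w' ∈ {w : α | Encodable.encode w < m}, s w n = s w' n ↔ name w = name w' := by
      rw [eventually_all_finite hfin]
      intro w _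
      rw [eventually_all_finite hfin]
      exact fun w' _ => hname w w'
    filter_upwards [this] with n hn
    obtain ⟨R, hR⟩ := exists_perm_apply_eq hfin.toFinset (fun w => s w n) name
      (fun x hx y hy => hn x (by simpa using hx) y (by simpa using hy))
    exact ⟨R, fun w hw => hR w (by simpa using hw)⟩
  -- Diagonal choice: `R n` treats the longest initial segment of `α`, of length at most `n`, that
  -- can be renamed correctly at stage `n`. The empty segment always works, with the identity
  -- permutation.
  have hsel : ∀ n, Q n (Nat.findGreatest (Q n) n) := fun n =>
    Nat.findGreatest_spec (P := Q n) (Nat.zero_le n) ⟨1, by simp⟩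
  choose R hR using hsel
  refine ⟨R, name, fun w => ?_⟩
  filter_upwards [hQ (Encodable.encode w + 1), hU (eventually_ge_atTop (Encodable.encode w + 1))]
    with n h1 h2
  exact hR n w (Nat.le_findGreatest h2 h1)

open Classical in
/-- The vertex linked to the port `u : i`, or `u` itself if there is none. -/
noncomputable def step (G : PortGraph V S D p) (i : Fin p) (u : V) : V :=
  if h : ∃ z, G.edge (u, i) z ≠ none ∨ G.edge z (u, i) ≠ none then h.choose.1 else u

theorem eq_step {G : PortGraph V S D p} {i : Fin p} {u : V} {z : V × Fin p}
    (hz : G.edge (u, i) z ≠ none ∨ G.edge z (u, i) ≠ none) : z.1 = G.step i u := by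
  have h : ∃ z, G.edge (u, i) z ≠ none ∨ G.edge z (u, i) ≠ none := ⟨z, hz⟩
  rw [step, dif_pos h]
  congr 1
  rcases hz with h1 | h1 <;> rcases h.choose_spec with h2 | h2
  · exact G.source_unique _ _ _ h1 h2
  · exact (G.source_or_target _ _ _ h1 h2).elim
  · exact (G.source_or_target _ _ _ h2 h1).elim
  · exact G.target_unique _ _ _ h1 h2

/-- The vertex reached from `v` by a sequence of port moves in the graphs of a family. -/
noncomputable def walkEnd {ι : Type*} (G : ι → PortGraph V S D p) (v : V) :
    List (ι × Fin p) → V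
  | [] => v
  | a :: l => (G a.1).step a.2 (walkEnd G v l)

/-- Sequences of pointed graphs stabilize along an ultrafilter, after renaming. -/
theorem exists_stabilizes_rename [Infinite V] {ι : Type*} [Countable ι] (U : Ultrafilter ℕ)
    (hU : (U : Filter ℕ) ≤ atTop) (G : ι → ℕ → PortGraph V S D p) (v : ℕ → V) :
    ∃ (R : ℕ → Equiv.Perm V) (X : Set V) (v₀ : V), X.Countable ∧ v₀ ∈ X ∧
      (∀ᶠ n in U, R n (v n) = v₀) ∧ ∀ c, Stabilizes U X fun n => (G c n).rename (R n) := by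
  obtain ⟨R, name, hR⟩ := exists_perm_eventually_eq U hU
    -- The words mix moves in all the graphs of the family, so that one set of names `X` serves
    -- every member and is closed under the moves of each.
    fun (l : List (ι × Fin p)) n => walkEnd (fun c => G c n) (v n) l
  refine ⟨R, Set.range name, name [], Set.countable_range name, ⟨_, rfl⟩, hR [], fun c => ?_⟩
  rintro _ ⟨l, rfl⟩ i
  refine ⟨name ((c, i) :: l), ⟨_, rfl⟩, ?_⟩
  filter_upwards [hR l, hR ((c, i) :: l)] with n h1 h2 z hz
  rw [← h1] at hz
  rw [← h2, ← Equiv.symm_apply_eq]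
  exact eq_step (z := ((R n).symm z.1, z.2)) (by simpa [rename] using hz)

end Names

/-! ### Locality of the inverse, and causality. -/

section Inverse

variable {V S D : Type*} {p : ℕ}

/-- The inverse of a local map preserving vertices and commuting with renaming is local. -/
theorem exists_isLocal_inverse [Infinite V] [Finite S] [Finite D]
    {K K' : PortGraph V S D p → PortGraph V S D p} {r : ℕ} (hloc : IsLocal K r)
    (hverts : ∀ G, (K G).verts = G.verts)
    (hren : ∀ (R : Equiv.Perm V) G, K (G.rename R) = (K G).rename R)
    (hl : ∀ G, K' (K G) = G) (hr : ∀ G, K (K' G) = G) :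
    ∃ r', IsLocal K' r' := by
  by_contra hcon
  simp only [IsLocal, not_exists, not_forall] at hcon
  choose G H v hagree hne using hcon
  have hverts' : ∀ G, (K' G).verts = G.verts := fun G => by rw [← hverts (K' G), hr]
  let U : Ultrafilter ℕ := hyperfilter ℕ
  have hU : (U : Filter ℕ) ≤ atTop := Nat.hyperfilter_le_atTop
  obtain ⟨R, X, v₀, hX, hv₀, hRv, hst⟩ := exists_stabilizes_rename U hU
    (fun (c : Bool) n => K' (cond c (G n) (H n))) v
  have hP := hst true
  have hQ := hst false
  simp only [cond_true, cond_false] at hP hQ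
  set P := fun n => (K' (G n)).rename (R n) with hPdef
  set Q := fun n => (K' (H n)).rename (R n) with hQdef
  have hKP : ∀ n, K (P n) = (G n).rename (R n) := fun n => by rw [hPdef, hren, hr]
  have hKQ : ∀ n, K (Q n) = (H n).rename (R n) := fun n => by rw [hQdef, hren, hr]
  have hsub : (K (limit U X hX P)).verts ⊆ X := by
    rw [hverts]
    exact fun _ h => h.1
  -- As `K` preserves vertices, walks in `K` of the limit stay in `X`, where `K (P n)` eventually
  -- agrees with it.
  have hpow : ∀ k u, (K (limit U X hX P)).AdjPow k v₀ u →
      ∀ᶠ n in U, (K (P n)).AdjPow k v₀ u := by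
    intro k
    induction k with
    | zero => exact fun u hu => Eventually.of_forall fun _ => hu
    | succ k ih =>
      rintro u ⟨w, h1, h2⟩
      have hw : w ∈ X := hsub h2.mem_left
      filter_upwards [ih w h1, hP.eventually_agreeAt_map_limit (hX := hX) hloc hw] with n h3 h4
      exact ⟨w, h3, h4.adj_iff.1 h2⟩
  have hcomp : ∀ k u, (K (limit U X hX P)).AdjPow k v₀ u →
      AgreeAt (K (limit U X hX P)) (K (limit U X hX Q)) u := by
    intro k u hu
    have huX : u ∈ X := hu.mem_of_verts_subset hsub hv₀
    -- With `n ≥ k`, the endpoint `u` lies in the ball on which the renamed `G n` and `H n` agree.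
    obtain ⟨n, h1, h2, h3, h4, h5⟩ := ((hpow k u hu).and
      ((hP.eventually_agreeAt_map_limit (hX := hX) hloc huX).and
      ((hQ.eventually_agreeAt_map_limit (hX := hX) hloc huX).and
      (hRv.and (hU (eventually_ge_atTop k)))))).exists
    rw [hKP, adjPow_rename, ← h4, Equiv.symm_apply_apply] at h1
    have h6 := agreeAt_rename.2 (hagree n k h5 _ h1)
    rw [← hKP, ← hKQ] at h6
    exact h2.trans (h6.trans h3.symm)
  have hlim := agreeAt_of_agreeAt_component hloc hverts hverts' hl hr hcomp
  rw [hl, hl] at hlim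
  obtain ⟨n, h1, h2, h3⟩ := ((hP.eventually_agreeAt_limit (hX := hX) hv₀).and
    ((hQ.eventually_agreeAt_limit (hX := hX) hv₀).and hRv)).exists
  have h4 := agreeAt_rename.1 (h1.symm.trans (hlim.trans h2))
  rw [← h3, Equiv.symm_apply_apply] at h4
  exact hne n h4

/-- The graph with one vertex, no state and no edge. -/
def single (S D : Type*) (p : ℕ) (v : V) : PortGraph V S D p where
  verts := {v}
  countable_verts := Set.countable_singleton v
  state _ := none
  state_eq_none _ _ := rfl
  edge _ _ := none
  edge_mem _ _ h := absurd rfl h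
  source_unique _ _ _ h := absurd rfl h
  target_unique _ _ _ h := absurd rfl h
  source_or_target _ _ _ h := absurd rfl h

theorem mem_single_verts {u v : V} : u ∈ (single S D p v).verts ↔ u = v := Iff.rfl

variable {F F' : PortGraph V S D p → PortGraph V S D p}

/-- Freshness is applied to the family of all graphs whose image contains `v`. -/
theorem IsDynamics.antecedents_nonempty (hF : IsDynamics F) (v : V) :
    (antecedents F v).Nonempty := by
  by_contra h
  have h1 : (⋂ G ∈ {G | v ∈ (F G).verts}, G.verts) = ∅ := by
    rw [Set.eq_empty_iff_forall_notMem]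
    intro u hu
    rw [Set.mem_iInter₂] at hu
    exact h ⟨u, fun G hG => hu G hG⟩
  have h2 : v ∈ ⋂ G ∈ {G | v ∈ (F G).verts}, (F G).verts :=
    Set.mem_iInter₂.2 fun G hG => hG
  rw [hF.freshness _ h1] at h2
  exact h2

/-- An invertible dynamics preserves the set of vertices, up to a fixed renaming. -/
theorem exists_perm_mem_verts_iff (hF : IsDynamics F) (hF' : IsDynamics F')
    (hl : ∀ G, F' (F G) = G) (hr : ∀ G, F (F' G) = G) :
    ∃ f : Equiv.Perm V, ∀ G v, v ∈ (F G).verts ↔ f v ∈ G.verts := by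
  choose f hf using hF.antecedents_nonempty
  choose g hg using hF'.antecedents_nonempty
  have hg' : ∀ G v, v ∈ G.verts → g v ∈ (F G).verts := fun G v h =>
    hg v (F G) (by rwa [hl])
  -- One-vertex graphs force the chosen antecedents to be mutually inverse. Here the test graph is
  -- the preimage of `single S D p x`.
  have hgf : ∀ x, g (f x) = x := fun x => by
    have := hg' _ _ (hf x (F' (single S D p x)) (by rw [hr]; rfl))
    rwa [hr] at this
  have hfg : ∀ x, f (g x) = x := fun x =>
    hf (g x) (single S D p x) (hg' _ _ rfl)
  refine ⟨⟨f, g, hgf, hfg⟩, fun G v => ⟨hf v G, fun h => ?_⟩⟩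
  have := hg' G _ h
  rwa [Equiv.coe_fn_mk, hgf] at this

/-- Conjugacy only provides some `R'`, but evaluating vertex sets on one-vertex graphs forces `R' =
f⁻¹ * R * f`. -/
theorem map_rename_of_conjugacy (hF : IsDynamics F) {f : Equiv.Perm V}
    (hf : ∀ G v, v ∈ (F G).verts ↔ f v ∈ G.verts) (R : Equiv.Perm V)
    (G : PortGraph V S D p) :
    (F (G.rename R)).rename f = ((F G).rename f).rename R := by
  obtain ⟨R', hR'⟩ := hF.conjugacy R
  have key : f * R' = R * f := by
    ext v
    have h1 : R' v ∈ ((F (single S D p (f v))).rename R').verts := by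
      rw [mem_rename_verts, Equiv.symm_apply_apply, hf]
      rfl
    rw [← hR', hf, mem_rename_verts, mem_single_verts, Equiv.symm_apply_eq] at h1
    exact h1
  rw [hR', rename_rename, rename_rename, key]

theorem IsCausal.isCausal_inverse [Infinite V] [Finite S] [Finite D] (hF : IsCausal F)
    (hF' : IsDynamics F') (hl : ∀ G, F' (F G) = G) (hr : ∀ G, F (F' G) = G) : IsCausal F' := by
  obtain ⟨hdyn, r, b, hdisk, -⟩ := hF
  obtain ⟨f, hf⟩ := exists_perm_mem_verts_iff hdyn hF' hl hr
  have hfa : ∀ v, f v ∈ antecedents F v := fun v G h => (hf G v).1 h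
  have hf' : ∀ G v, v ∈ (F' G).verts ↔ f.symm v ∈ G.verts := fun G v => by
    have h := hf (F' G) (f.symm v)
    rw [hr, Equiv.apply_symm_apply] at h
    exact h.symm
  -- Antecedents under `F'` are unique, and `f` is injective, whence the bound `1` below.
  have hanti : ∀ v, ∀ v' ∈ antecedents F' v, v' = f.symm v := fun v v' h =>
    h (single S D p (f.symm v)) ((hf' _ v).2 rfl)
  have hloc : IsLocal (fun G => (F G).rename f) r := fun G H v h => by
    refine agreeAt_rename.2 (induced_singleton_eq_iff.1 (hdisk _ v ?_ G H (disk_eq_of_agreeAt h)))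
    simpa using hfa (f.symm v)
  obtain ⟨r', hr'⟩ := exists_isLocal_inverse (K' := fun G => F' (G.rename f⁻¹)) hloc
    (fun G => by ext v; simp [mem_rename_verts, hf])
    (fun R G => map_rename_of_conjugacy hdyn hf R G)
    (fun G => by simp only [rename_rename, inv_mul_cancel, rename_one, hl])
    (fun G => by simp only [hr, rename_rename, mul_inv_cancel, rename_one])
  refine ⟨hF', r', 1, fun v v' hv' G H hGH => ?_, fun G v' _ => ?_⟩
  · rw [hanti v v' hv'] at hGH
    rw [induced_singleton_eq_iff]
    -- `F' G` is the local inverse evaluated at `G.rename f`, and the disk around `v` there is the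
    -- renamed disk of `G` around `f.symm v`.
    have := hr' (G.rename f) (H.rename f) v fun k hk u hu =>
      agreeAt_rename.2 (agreeAt_of_disk_eq hGH hk (adjPow_rename.1 hu))
    simpa only [rename_rename, inv_mul_cancel, rename_one] using this
  · refine Set.encard_le_one_iff.2 fun x y hx hy => ?_
    exact f.symm.injective ((hanti x v' hx.2).symm.trans (hanti y v' hy.2))

end Inverse

end PortGraph

theorem theorem4 {V S D : Type*} [Uncountable V] [Finite S] [Finite D] (p : ℕ)
    (F F' : PortGraph V S D p → PortGraph V S D p)
    (hF : PortGraph.IsCausal F) (hF' : PortGraph.IsInverseDynamics F F') :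
    PortGraph.IsCausal F' :=
  hF.isCausal_inverse hF'.isDynamics (congrFun hF'.comp_left) (congrFun hF'.comp_right)
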